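/- Let $T$ be a finite tree of order $n$ (i.e. with $n$ vertices), and let $k\ge 3$ be an integer with $k<\operatorname{rad}(T)$, where $\operatorname{rad}(T)=\min_{u}\max_{v} d(u,v)$ is the radius of $T$. A dominating $k$-broadcast on $T$ is a function $f\colon V(T)\to\{0,1,\dots,k\}$ such that for every vertex $u$ there is a vertex $v$ with $f(v)\ge 1$ and $d(u,v)\le f(v)$. The dominating $k$-broadcast number $\gamma_{B_k}(T)$ is the minimum of the cost $\sum_{v\in V(T)} f(v)$ over all dominating $k$-broadcasts $f$ on $T$. Then $$\gamma_{B_k}(T)\le \left\lceil \frac{k+2}{k+1}\cdot\frac{n}{3}\right\rceil .$$ -/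

import Mathlib

/-- `f` is a dominating `k`-broadcast on `G`: its values lie in `{0, 1, …, k}` and every vertex `u`
is within distance `f v` of some vertex `v` with `f v ≥ 1`. The distance is the extended one,
so that vertices in different components are never close to each other. -/
def IsDominatingKBroadcast {V : Type*} (G : SimpleGraph V) (k : ℕ) (f : V → ℕ) : Prop :=
  (∀ v, f v ≤ k) ∧ ∀ u, ∃ v, 1 ≤ f v ∧ G.edist u v ≤ (f v : ℕ∞)

/-- The cost of a broadcast. -/
def broadcastCost {V : Type*} [Fintype V] (f : V → ℕ) : ℕ :=
  ∑ v, f v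

/-- The dominating `k`-broadcast number of `G`: the minimum cost of a dominating `k`-broadcast.
For `k ≥ 1` the minimum is attained, see `dominatingKBroadcastNumber_isLeast`. -/
noncomputable def dominatingKBroadcastNumber {V : Type*} [Fintype V] (G : SimpleGraph V)
    (k : ℕ) : ℕ :=
  sInf {c : ℕ | ∃ f : V → ℕ, IsDominatingKBroadcast G k f ∧ broadcastCost f = c}

theorem dominatingKBroadcastNumber_isLeast {V : Type*} [Fintype V] (G : SimpleGraph V)
    (k : ℕ) (hk : 1 ≤ k) :
    IsLeast {c : ℕ | ∃ f : V → ℕ, IsDominatingKBroadcast G k f ∧ broadcastCost f = c}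
      (dominatingKBroadcastNumber G k) := by
  have hne : {c : ℕ | ∃ f : V → ℕ, IsDominatingKBroadcast G k f ∧ broadcastCost f = c}.Nonempty :=
    ⟨_, fun _ => 1, ⟨fun _ => hk, fun u => ⟨u, le_rfl, by simp⟩⟩, rfl⟩
  exact ⟨Nat.sInf_mem hne, fun c hc => Nat.sInf_le hc⟩

/-!
Throughout, `c = (k + 2) / (3 * (k + 1))`. The proof is a strong induction on the order `n`, which
cuts off branches of the tree `T`, rooted at some vertex `r`: if the branch at `x ≠ r` can be
dominated at cost at most `c` times its size, what remains is a smaller tree and its bound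
`⌈c * n⌉` absorbs the cost. The radius plays no role, since for `n ≤ 3 * k` the bound follows from
the one for broadcasts of unbounded strength.

*Unbounded strength* (`covers_univ_third`): the cost `⌈n / 3⌉` suffices. Root the tree at a center,
with radius `R`. If no branch can be cut off, no branch size is divisible by three, so along a path
the branch sizes run through a strictly increasing sequence of non-multiples of three and a branch
of height `h` has at least `⌊3 * h / 2⌋ + 1` vertices (`chain_bound`). The center has two children
with branches of height at least `R - 1` and `R - 2`, so `n ≥ 3 * R - 2` when `R ≥ 2`, and a single
ball of radius `⌈n / 3⌉ ≥ R` around the center dominates the tree.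

*Strength at most `k`* (`exists_covers_univ`): a branch of size `s ≤ 3 * k` can be dominated at cost
`⌈s / 3⌉ ≤ k` by the first part. If no branch can be cut off, comparing this with `c * s` leaves
only sizes `s ≤ 2 * k + 1` that are not divisible by three and, when they exceed `k`, are congruent
to one modulo three, besides sizes above `3 * k`. Take a smallest branch of size more than `3 * k`,
at `x`. So few sizes are available below `x` that this branch has height at most `k + 1`, with at
most one vertex of depth `k + 1` below each child of `x` (`twin_chain_bound`), and a child with such
a vertex has a branch of at least `2 * k` vertices. Hence a ball of radius `k` around `x`, with one
unit for every vertex of depth `k + 1`, dominates the branch at cost at most `c` times its size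
(`covers_branch`), and the branch at `x` can be cut off after all.
-/

open Finset

universe u

/-! ### Covering sets of vertices by bounded broadcasts -/

/-- The vertices of `A` are dominated by a broadcast on `G` with values at most `k` and cost at
most `m`. The broadcasting vertices need not belong to `A`. -/
def Covers {V : Type u} [Fintype V] (G : SimpleGraph V) (k : ℕ) (A : Set V) (m : ℕ) : Prop :=
  ∃ f : V → ℕ, (∀ v, f v ≤ k) ∧ ∑ v, f v ≤ m ∧
    ∀ u ∈ A, ∃ v, 1 ≤ f v ∧ G.edist u v ≤ (f v : ℕ∞)

namespace Covers

variable {V : Type u} [Fintype V] {G : SimpleGraph V} {k k' m m' : ℕ} {A B : Set V}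

theorem mono (h : Covers G k A m) (hk : k ≤ k') (hm : m ≤ m') (hB : B ⊆ A) :
    Covers G k' B m' := by
  obtain ⟨f, hf, hc, hd⟩ := h
  exact ⟨f, fun v => (hf v).trans hk, hc.trans hm, fun u hu => hd u (hB hu)⟩

theorem union (hA : Covers G k A m) (hB : Covers G k B m') : Covers G k (A ∪ B) (m + m') := by
  obtain ⟨f, hf, hfc, hfd⟩ := hA
  obtain ⟨g, hg, hgc, hgd⟩ := hB
  refine ⟨fun v => max (f v) (g v), fun v => max_le (hf v) (hg v), ?_, ?_⟩
  · calc ∑ v, max (f v) (g v) ≤ ∑ v, (f v + g v) :=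
          sum_le_sum fun v _ => max_le_add_of_nonneg (Nat.zero_le _) (Nat.zero_le _)
      _ ≤ m + m' := by rw [sum_add_distrib]; omega
  · rintro u (hu | hu)
    · obtain ⟨v, h1, h2⟩ := hfd u hu
      exact ⟨v, h1.trans (le_max_left _ _), h2.trans (by exact_mod_cast le_max_left _ _)⟩
    · obtain ⟨v, h1, h2⟩ := hgd u hu
      exact ⟨v, h1.trans (le_max_right _ _), h2.trans (by exact_mod_cast le_max_right _ _)⟩

theorem ball [DecidableEq V] (G : SimpleGraph V) (x : V) {ρ : ℕ} (hρ : 1 ≤ ρ) :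
    Covers G ρ {u | G.edist u x ≤ (ρ : ℕ∞)} ρ := by
  refine ⟨fun v => if v = x then ρ else 0, fun v => ?_, by simp, fun u hu => ⟨x, ?_⟩⟩
  · dsimp only; split_ifs <;> omega
  · simpa using ⟨hρ, hu⟩

theorem finset [DecidableEq V] (G : SimpleGraph V) (E : Finset V) :
    Covers G 1 (E : Set V) E.card := by
  refine ⟨fun v => if v ∈ E then 1 else 0, fun v => ?_, by simp, fun u hu => ⟨u, ?_⟩⟩
  · dsimp only; split_ifs <;> omega
  · have : u ∈ E := hu
    simp [this]

/-- Distances in an induced subgraph are at least those in the graph, so a broadcast on the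
subgraph dominates the same vertices in the graph. -/
theorem of_induce {s : Set V} [Fintype s] (h : Covers (G.induce s) k Set.univ m) :
    Covers G k s m := by
  classical
  obtain ⟨f, hf, hc, hd⟩ := h
  refine ⟨fun v => if hv : v ∈ s then f ⟨v, hv⟩ else 0, fun v => ?_, ?_, fun u hu => ?_⟩
  · dsimp only; split_ifs
    · exact hf _
    · omega
  · refine le_trans (le_of_eq ?_) hc
    rw [← Finset.sum_subset (Finset.subset_univ (Finset.univ.filter (· ∈ s)))]
    · rw [Finset.sum_subtype (p := (· ∈ s)) _ (by simp)]
      exact Finset.sum_congr rfl fun v _ => by simp [v.2]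
    · intro v _ hv
      simp at hv
      simp [hv]
  · obtain ⟨v, h1, h2⟩ := hd ⟨u, hu⟩ trivial
    refine ⟨v, by simpa using h1, ?_⟩
    simp only [v.2, dite_true]
    obtain ⟨p, hp⟩ := SimpleGraph.exists_walk_of_edist_ne_top
      (ne_top_of_le_ne_top (ENat.natCast_ne_top _) h2)
    refine le_trans ?_ h2
    rw [← hp]
    have := SimpleGraph.edist_le (p.map (SimpleGraph.Embedding.induce s).toHom)
    rwa [SimpleGraph.Walk.length_map] at this

end Covers

/-! ### Distances in trees -/

section Dist

variable {V : Type u} {T : SimpleGraph V} {r x y u : V}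

theorem exists_adj_dist_add_one (hT : T.IsTree) (h : x ≠ u) :
    ∃ y, T.Adj x y ∧ T.dist y u + 1 = T.dist x u := by
  obtain ⟨p, hp⟩ := hT.connected.exists_walk_length_eq_dist x u
  cases p with
  | nil => exact absurd rfl h
  | cons hadj q =>
    rename_i w
    refine ⟨w, hadj, ?_⟩
    have h1 := SimpleGraph.dist_le q
    have h2 := hT.connected.dist_triangle (u := x) (v := w) (w := u)
    rw [SimpleGraph.dist_eq_one_iff_adj.2 hadj] at h2
    simp only [SimpleGraph.Walk.length_cons] at hp
    omega

theorem ne_root_of_dist (hy : T.dist r y = T.dist r x + 1) : y ≠ r := by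
  rintro rfl
  simp at hy

theorem edist_le_of_dist_le (hT : T.IsTree) {ρ : ℕ} (h : T.dist x u ≤ ρ) :
    T.edist u x ≤ (ρ : ℕ∞) := by
  rw [SimpleGraph.edist_comm, ← (hT.connected x u).coe_dist_eq_edist]
  exact_mod_cast h

/-- A set is connected if each of its vertices other than `x` has a neighbor in the set at which
the potential `g` is smaller. -/
theorem induce_connected_of_step {A : Set V} (x : V) (hx : x ∈ A) (g : V → ℕ)
    (h : ∀ u ∈ A, u ≠ x → ∃ w ∈ A, T.Adj u w ∧ g w < g u) : (T.induce A).Connected := by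
  rw [SimpleGraph.connected_iff_exists_forall_reachable]
  refine ⟨⟨x, hx⟩, ?_⟩
  suffices ∀ n, ∀ u (hu : u ∈ A), g u = n → (T.induce A).Reachable ⟨x, hx⟩ ⟨u, hu⟩ from
    fun w => this _ w.1 w.2 rfl
  intro n
  induction n using Nat.strong_induction_on with
  | _ n ih =>
    intro u hu hn
    by_cases hux : u = x
    · subst hux; rfl
    obtain ⟨w, hw, hadj, hlt⟩ := h u hu hux
    refine (ih _ (hn ▸ hlt) w hw rfl).trans (SimpleGraph.Adj.reachable ?_)
    simpa using hadj.symm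

end Dist

/-! ### Branches of a rooted tree -/

section Branch

variable {V : Type u} [Fintype V] (T : SimpleGraph V)

open Classical in
/-- The branch at `x` of the tree `T` rooted at `r`: the vertices whose path from `r` passes
through `x`. -/
noncomputable def branch (r x : V) : Finset V :=
  {u | T.dist r x + T.dist x u = T.dist r u}

variable {T} {r x y y' z u u' : V}

theorem mem_branch : u ∈ branch T r x ↔ T.dist r x + T.dist x u = T.dist r u := by
  simp [branch]

theorem self_mem_branch : x ∈ branch T r x := by simp [mem_branch]

theorem branch_root : branch T r r = univ := by ext; simp [mem_branch]

/-- Every vertex of a branch other than its root lies in the branch of a child. -/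
theorem exists_child (hT : T.IsTree) (hu : u ∈ branch T r x) (hne : x ≠ u) :
    ∃ y, T.Adj x y ∧ T.dist r y = T.dist r x + 1 ∧ u ∈ branch T r y ∧
      T.dist y u + 1 = T.dist x u := by
  obtain ⟨y, hadj, hy⟩ := exists_adj_dist_add_one hT hne
  rw [mem_branch] at hu
  have h1 := hT.connected.dist_triangle (u := r) (v := x) (w := y)
  have h2 := hT.connected.dist_triangle (u := r) (v := y) (w := u)
  rw [SimpleGraph.dist_eq_one_iff_adj.2 hadj] at h1
  exact ⟨y, hadj, by omega, by rw [mem_branch]; omega, hy⟩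

theorem branch_subset_of_child [DecidableEq V] (hT : T.IsTree) (hadj : T.Adj x y)
    (hy : T.dist r y = T.dist r x + 1) : branch T r y ⊆ (branch T r x).erase x := by
  intro u hu
  rw [mem_branch] at hu
  have h1 := hT.connected.dist_triangle (u := r) (v := x) (w := u)
  have h2 := hT.connected.dist_triangle (u := x) (v := y) (w := u)
  rw [SimpleGraph.dist_eq_one_iff_adj.2 hadj] at h2
  rw [mem_erase, mem_branch]
  refine ⟨?_, by omega⟩
  rintro rfl
  omega

/-- In a tree, the point of a geodesic at a given distance from its start is unique, so branches
at the same level are disjoint. -/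
theorem disjoint_branch (hT : T.IsTree) (hd : T.dist r y = T.dist r y') (hne : y ≠ y') :
    Disjoint (branch T r y) (branch T r y') := by
  rw [Finset.disjoint_left]
  intro u hu hu'
  rw [mem_branch] at hu hu'
  apply hne
  obtain ⟨p, hp⟩ := hT.connected.exists_walk_length_eq_dist r y
  obtain ⟨q, hq⟩ := hT.connected.exists_walk_length_eq_dist y u
  obtain ⟨p', hp'⟩ := hT.connected.exists_walk_length_eq_dist r y'
  obtain ⟨q', hq'⟩ := hT.connected.exists_walk_length_eq_dist y' u
  have h1 : (p.append q).IsPath :=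
    SimpleGraph.Walk.isPath_of_length_eq_dist _ (by rw [SimpleGraph.Walk.length_append]; omega)
  have h2 : (p'.append q').IsPath :=
    SimpleGraph.Walk.isPath_of_length_eq_dist _ (by rw [SimpleGraph.Walk.length_append]; omega)
  have h3 := congrArg (fun w => w.getVert p.length) ((hT.existsUnique_path r u).unique h1 h2)
  have h4 : p.length = p'.length := by omega
  simpa [SimpleGraph.Walk.getVert_append, h4] using h3

theorem branch_induce_isTree (hT : T.IsTree) :
    (T.induce (branch T r x : Set V)).IsTree := by
  refine ⟨induce_connected_of_step x self_mem_branch (fun u => T.dist u x) ?_,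
    hT.isAcyclic.induce _⟩
  intro u hu hne
  obtain ⟨w, hadj, hw⟩ := exists_adj_dist_add_one hT hne
  refine ⟨w, ?_, hadj, by omega⟩
  rw [mem_coe, mem_branch] at *
  have h1 := hT.connected.dist_triangle (u := r) (v := w) (w := u)
  have h2 := hT.connected.dist_triangle (u := r) (v := x) (w := w)
  have h3 := SimpleGraph.dist_eq_one_iff_adj.2 hadj
  rw [T.dist_comm (u := w) (v := x), T.dist_comm (u := u) (v := x)] at hw
  rw [T.dist_comm] at h3
  omega

theorem compl_branch_induce_isTree (hT : T.IsTree) (hx : x ≠ r) :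
    (T.induce ((branch T r x : Set V)ᶜ)).IsTree := by
  refine ⟨induce_connected_of_step r ?_ (fun u => T.dist u r) ?_, hT.isAcyclic.induce _⟩
  · rw [Set.mem_compl_iff, mem_coe, mem_branch]
    have := hT.connected.pos_dist_of_ne hx.symm
    rw [T.dist_self]
    omega
  · intro u hu hne
    obtain ⟨w, hadj, hw⟩ := exists_adj_dist_add_one hT hne
    refine ⟨w, ?_, hadj, by omega⟩
    rw [Set.mem_compl_iff, mem_coe, mem_branch] at *
    have h1 := hT.connected.dist_triangle (u := r) (v := x) (w := u)
    have h2 := hT.connected.dist_triangle (u := x) (v := w) (w := u)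
    have h3 := SimpleGraph.dist_eq_one_iff_adj.2 hadj
    rw [T.dist_comm (u := w) (v := r), T.dist_comm (u := u) (v := r)] at hw
    rw [T.dist_comm] at h3
    omega

theorem card_branch_add_one_le (hT : T.IsTree) (hadj : T.Adj x y)
    (hy : T.dist r y = T.dist r x + 1) : (branch T r y).card + 1 ≤ (branch T r x).card := by
  classical
  have := card_le_card (branch_subset_of_child hT hadj hy)
  rw [card_erase_of_mem self_mem_branch] at this
  have := card_pos.2 ⟨x, self_mem_branch (T := T) (r := r)⟩
  omega

theorem card_branch_add_card_branch_add_one_le (hT : T.IsTree) (hadj : T.Adj x y)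
    (hy : T.dist r y = T.dist r x + 1) (hadj' : T.Adj x y') (hy' : T.dist r y' = T.dist r x + 1)
    (hne : y ≠ y') :
    (branch T r y).card + (branch T r y').card + 1 ≤ (branch T r x).card := by
  classical
  have := card_le_card (union_subset (branch_subset_of_child hT hadj hy)
    (branch_subset_of_child hT hadj' hy'))
  rw [card_erase_of_mem self_mem_branch,
    card_union_of_disjoint (disjoint_branch hT (hy.trans hy'.symm) hne)] at this
  have := card_pos.2 ⟨x, self_mem_branch (T := T) (r := r)⟩
  omega

/-- Cutting off the branch at `x` and dominating the two parts separately. -/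
theorem Covers.of_branch {k a b : ℕ} (ha : Covers T k (branch T r x : Set V) a)
    [Fintype ((branch T r x : Set V)ᶜ : Set V)]
    (hb : Covers (T.induce ((branch T r x : Set V)ᶜ)) k Set.univ b) :
    Covers T k Set.univ (a + b) :=
  (ha.union hb.of_induce).mono le_rfl le_rfl (by simp)

theorem card_compl_branch [Fintype ((branch T r x : Set V)ᶜ : Set V)] :
    Fintype.card ((branch T r x : Set V)ᶜ : Set V) = Fintype.card V - (branch T r x).card := by
  classical
  rw [Fintype.card_compl_set]
  simp

end Branch

/-! ### Sizes of branches when only certain sizes occur -/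

section Chain

variable {V : Type u} [Fintype V] {T : SimpleGraph V} {r : V} {k : ℕ}

/-- The sizes of the branches on the path from `x` down to `u` strictly increase, and only the
sizes allowed by `hs` are available for them; this bounds the length of the path. -/
theorem chain_bound (hT : T.IsTree)
    (hs : ∀ z, z ≠ r → (branch T r z).card ≤ 2 * k + 1 → (branch T r z).card % 3 ≠ 0 ∧
      (k < (branch T r z).card → (branch T r z).card % 3 = 1)) :
    ∀ (h : ℕ) (x u : V), x ≠ r → (branch T r x).card ≤ 2 * k + 1 → u ∈ branch T r x →
      T.dist x u = h →
      ((branch T r x).card ≤ k → 3 * h + 1 ≤ 2 * (branch T r x).card) ∧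
      (k < (branch T r x).card → 3 * h ≤ (branch T r x).card + k) := by
  intro h
  induction h with
  | zero =>
    intro x u _ _ _ _
    have := card_pos.2 ⟨x, self_mem_branch (T := T) (r := r)⟩
    omega
  | succ h ih =>
    intro x u hx hc hu hd
    have hne : x ≠ u := by rintro rfl; simp at hd
    obtain ⟨y, hadj, hy, huy, hyu⟩ := exists_child hT hu hne
    have h1 := card_branch_add_one_le hT hadj hy
    have h2 := ih y u (ne_root_of_dist hy) (by omega) huy (by omega)
    have h3 := hs x hx hc
    have h4 := hs y (ne_root_of_dist hy) (by omega)
    omega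

/-- Two vertices at the same distance `h` below `x` enlarge the branch at `x` at least as much as
one vertex at distance `h + 1`. -/
theorem twin_chain_bound (hT : T.IsTree) (hk : 3 ≤ k)
    (hs : ∀ z, z ≠ r → (branch T r z).card ≤ 2 * k + 1 → (branch T r z).card % 3 ≠ 0 ∧
      (k < (branch T r z).card → (branch T r z).card % 3 = 1)) :
    ∀ (h : ℕ) (x u u' : V), x ≠ r → (branch T r x).card ≤ 2 * k + 1 → u ∈ branch T r x →
      u' ∈ branch T r x → u ≠ u' → T.dist x u = h → T.dist x u' = h →
      ((branch T r x).card ≤ k → 3 * (h + 1) + 1 ≤ 2 * (branch T r x).card) ∧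
      (k < (branch T r x).card → 3 * (h + 1) ≤ (branch T r x).card + k) := by
  intro h
  induction h with
  | zero =>
    intro x u u' _ _ _ _ hne hd hd'
    rw [hT.connected.dist_eq_zero_iff] at hd hd'
    exact absurd (hd.symm.trans hd') hne
  | succ h ih =>
    intro x u u' hx hc hu hu' hne hd hd'
    obtain ⟨y, hadj, hy, huy, hyu⟩ := exists_child hT hu (by rintro rfl; simp at hd)
    obtain ⟨y', hadj', hy', huy', hyu'⟩ := exists_child hT hu' (by rintro rfl; simp at hd')
    have h1 := card_branch_add_one_le hT hadj hy
    have h1' := card_branch_add_one_le hT hadj' hy'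
    have h3 := hs x hx hc
    have h4 := hs y (ne_root_of_dist hy) (by omega)
    have h4' := hs y' (ne_root_of_dist hy') (by omega)
    by_cases hyy : y = y'
    · subst hyy
      have h2 := ih y u u' (ne_root_of_dist hy) (by omega) huy huy' hne (by omega) (by omega)
      omega
    · have h2 := chain_bound hT hs h y u (ne_root_of_dist hy) (by omega) huy (by omega)
      have h2' := chain_bound hT hs h y' u' (ne_root_of_dist hy') (by omega) huy' (by omega)
      have h5 := card_branch_add_card_branch_add_one_le hT hadj hy hadj' hy' hyy
      rcases Nat.eq_zero_or_pos h with h0 | h0 <;> omega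

end Chain

/-! ### Broadcasts of unbounded strength -/

/-- A vertex `r` of minimum eccentricity `R`. -/
theorem exists_center {V : Type u} [Fintype V] [Nonempty V] (T : SimpleGraph V) :
    ∃ (r : V) (R : ℕ), (∀ u, T.dist r u ≤ R) ∧ ∀ x, ∃ u, R ≤ T.dist x u := by
  classical
  have hex : ∃ R, ∃ r, ∀ u, T.dist r u ≤ R := by
    obtain ⟨r⟩ := ‹Nonempty V›
    exact ⟨univ.sup (T.dist r), r, fun u => le_sup (f := T.dist r) (mem_univ u)⟩
  obtain ⟨r, hr⟩ := Nat.find_spec hex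
  refine ⟨r, Nat.find hex, hr, fun x => ?_⟩
  by_contra! hlt
  have h0 := hlt x
  exact Nat.find_min hex (m := Nat.find hex - 1) (by omega) ⟨x, fun u => by have := hlt u; omega⟩

/-- A tree with `n` vertices has a dominating broadcast of cost at most `⌈n / 3⌉`. Unless some
branch of size divisible by three can be cut off, the branches at the center are so large that a
single ball around the center is cheap enough. -/
theorem covers_univ_third (n : ℕ) : ∀ {V : Type u} [Fintype V] (T : SimpleGraph V), T.IsTree →
    Fintype.card V = n → Covers T ((n + 2) / 3) Set.univ ((n + 2) / 3) := by
  classical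
  induction n using Nat.strong_induction_on with
  | _ n ih =>
    intro V _ T hT hn
    have hne : Nonempty V := hT.connected.nonempty
    obtain ⟨r, R, hR, hR'⟩ := exists_center T
    by_cases hdvd : ∃ x, x ≠ r ∧ (branch T r x).card % 3 = 0
    · obtain ⟨x, hx, h3⟩ := hdvd
      have hpos := card_pos.2 ⟨x, self_mem_branch (T := T) (r := r)⟩
      have hlt : (branch T r x).card < n := by
        have h1 := (compl_branch_induce_isTree hT hx).connected.nonempty
        have h2 := Fintype.card_pos_iff.2 h1
        rw [card_compl_branch] at h2
        omega
      have h1 := ih (branch T r x).card hlt _ (branch_induce_isTree hT (r := r) (x := x)) (by simp)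
      have h2 := ih (n - (branch T r x).card) (by omega) _ (compl_branch_induce_isTree hT hx)
        (card_compl_branch.trans (by rw [hn]))
      -- the cost of the branch is exactly a third of its size, so nothing is lost in rounding
      refine Covers.mono (Covers.of_branch (h1.of_induce.mono ?_ le_rfl le_rfl)
        (h2.mono (k' := (n + 2) / 3) ?_ le_rfl le_rfl)) le_rfl ?_ le_rfl
      all_goals omega
    · push Not at hdvd
      have hcard : ∀ z, (branch T r z).card ≤ n := fun z => hn ▸ card_le_univ _
      have hch := chain_bound (k := n) hT (r := r) fun z hz _ =>
        ⟨hdvd z hz, fun h => absurd (hcard z) (by omega)⟩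
      have hpos : 1 ≤ n := hn ▸ Fintype.card_pos
      have hRn : R ≤ (n + 2) / 3 := by
        by_cases hR2 : R ≤ 1
        · omega
        obtain ⟨u, hu⟩ := hR' r
        have hu := le_antisymm (hR u) hu
        obtain ⟨y, hadj, hy, huy, hyu⟩ := exists_child (x := r) (r := r) hT (u := u)
          (by simp [branch_root]) (by rintro rfl; simp at hu; omega)
        obtain ⟨u', hu'⟩ := hR' y
        have h1 := hT.connected.dist_triangle (u := y) (v := r) (w := u')
        rw [SimpleGraph.dist_eq_one_iff_adj.2 hadj.symm] at h1
        obtain ⟨y', hadj', hy', huy', hyu'⟩ := exists_child (x := r) (r := r) hT (u := u')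
          (by simp [branch_root]) (by rintro rfl; simp at h1; omega)
        -- the branch at `y` is too shallow to contain `u'`
        have hyy : y ≠ y' := by
          rintro rfl
          have := hR u'
          omega
        have h2 := hch _ y u (ne_root_of_dist hy) (by have := hcard y; omega) huy rfl
        have h2' := hch _ y' u' (ne_root_of_dist hy') (by have := hcard y'; omega) huy' rfl
        have h3 := card_branch_add_card_branch_add_one_le hT hadj hy hadj' hy' hyy
        have := hcard y
        have := hcard y'
        have := hcard r
        omega
      refine (Covers.ball T r (ρ := (n + 2) / 3) (by omega)).mono le_rfl le_rfl ?_
      intro u _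
      exact edist_le_of_dist_le hT ((hR u).trans hRn)

/-! ### Broadcasts of bounded strength -/

section Bounded

variable {V : Type u} [Fintype V] {T : SimpleGraph V} {r x : V} {k : ℕ}

/-- A ball of radius `k` around `x` misses only vertices at distance `k + 1` from `x`, at most one
for each child of `x`, and a child whose branch contains a missed vertex has a branch of at least
`2 * k` vertices. -/
theorem covers_branch (hT : T.IsTree) (hk : 3 ≤ k)
    (hs : ∀ z, z ≠ r → (branch T r z).card ≤ 2 * k + 1 → (branch T r z).card % 3 ≠ 0 ∧
      (k < (branch T r z).card → (branch T r z).card % 3 = 1))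
    (hx : 3 * k + 1 ≤ (branch T r x).card)
    (hmin : ∀ y, (branch T r y).card < (branch T r x).card → (branch T r y).card ≤ 2 * k + 1) :
    ∃ m, Covers T k (branch T r x : Set V) m ∧
      3 * (k + 1) * m ≤ (k + 2) * (branch T r x).card := by
  classical
  set E := (branch T r x).filter fun u => k < T.dist x u with hE
  have hchild : ∀ u, ∃ y, u ∈ E → T.Adj x y ∧ T.dist r y = T.dist r x + 1 ∧ u ∈ branch T r y ∧
      T.dist y u = k ∧ 2 * k ≤ (branch T r y).card ∧ (branch T r y).card ≤ 2 * k + 1 := by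
    intro u
    by_cases hu : u ∈ E
    · obtain ⟨hu1, hu2⟩ := mem_filter.1 hu
      obtain ⟨y, hadj, hy, huy, hyu⟩ := exists_child hT hu1 (by rintro rfl; simp at hu2)
      have h1 := hmin y (by have := card_branch_add_one_le hT hadj hy; omega)
      have h2 := chain_bound hT hs _ y u (ne_root_of_dist hy) h1 huy rfl
      have h3 := hs y (ne_root_of_dist hy) h1
      exact ⟨y, fun _ => ⟨hadj, hy, huy, by omega, by omega, h1⟩⟩
    · exact ⟨u, fun h => absurd h hu⟩
  choose y hy using hchild
  have hinj : ∀ u ∈ E, ∀ u' ∈ E, u ≠ u' → y u ≠ y u' := by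
    intro u hu u' hu' hne heq
    obtain ⟨-, h2, h3, h4, h5, h6⟩ := hy u hu
    obtain ⟨-, -, h3', h4', -, -⟩ := hy u' hu'
    rw [← heq] at h3' h4'
    have := twin_chain_bound hT hk hs k (y u) u u' (ne_root_of_dist h2) h6 h3 h3' hne h4 h4'
    have := hs _ (ne_root_of_dist h2) h6
    omega
  have hcard : 2 * k * E.card + 1 ≤ (branch T r x).card := by
    have h1 : E.biUnion (fun u => branch T r (y u)) ⊆ (branch T r x).erase x :=
      biUnion_subset.2 fun u hu => branch_subset_of_child hT (hy u hu).1 (hy u hu).2.1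
    have h2 := card_le_card h1
    rw [card_erase_of_mem self_mem_branch, card_biUnion fun u hu u' hu' hne =>
      disjoint_branch hT ((hy u hu).2.1.trans (hy u' hu').2.1.symm) (hinj u hu u' hu' hne)] at h2
    have h3 := card_nsmul_le_sum E (fun u => (branch T r (y u)).card) (2 * k)
      fun u hu => (hy u hu).2.2.2.2.1
    rw [smul_eq_mul, mul_comm] at h3
    omega
  refine ⟨k + E.card, ?_, ?_⟩
  · refine ((Covers.ball T x (ρ := k) (by omega)).union
      ((Covers.finset T E).mono (k' := k) (by omega) le_rfl le_rfl)).mono le_rfl le_rfl ?_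
    intro u hu
    by_cases h : T.dist x u ≤ k
    · exact Or.inl (edist_le_of_dist_le hT h)
    · exact Or.inr (mem_coe.2 (mem_filter.2 ⟨hu, not_le.1 h⟩))
  -- for at most one missed vertex the bound `hx` on the size is the better one, otherwise `hcard`
  · generalize (branch T r x).card = s at *
    generalize E.card = e at *
    rcases Nat.lt_or_ge e 2 with he | he
    · calc 3 * (k + 1) * (k + e) ≤ 3 * (k + 1) * (k + 1) := by gcongr; omega
        _ ≤ (k + 2) * (3 * k + 1) := by nlinarith
        _ ≤ (k + 2) * s := by gcongr
    · refine le_trans ?_ (Nat.mul_le_mul_left (k + 2) hcard)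
      obtain ⟨d, rfl⟩ := Nat.exists_eq_add_of_le he
      obtain ⟨j, rfl⟩ := Nat.exists_eq_add_of_le hk
      ring_nf
      nlinarith [Nat.zero_le (d * j), Nat.zero_le (d * j ^ 2), Nat.zero_le (j ^ 2)]

end Bounded

/-- A tree with `n` vertices has a dominating `k`-broadcast whose cost `m` satisfies
`m < (k + 2) * n / (3 * (k + 1)) + 1`. -/
theorem exists_covers_univ {k : ℕ} (hk : 3 ≤ k) (n : ℕ) :
    ∀ {V : Type u} [Fintype V] (T : SimpleGraph V), T.IsTree → Fintype.card V = n →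
      ∃ m, Covers T k Set.univ m ∧ 3 * (k + 1) * m < (k + 2) * n + 3 * (k + 1) := by
  classical
  induction n using Nat.strong_induction_on with
  | _ n ih =>
    intro V _ T hT hn
    obtain ⟨r⟩ : Nonempty V := hT.connected.nonempty
    have hpos : ∀ z, 0 < (branch T r z).card := fun z =>
      card_pos.2 ⟨z, self_mem_branch (T := T) (r := r)⟩
    have hle : ∀ z, (branch T r z).card ≤ n := fun z => hn ▸ card_le_univ _
    -- a branch that can be dominated cheaply is cut off
    by_cases hcut : ∃ x a, Covers T k (branch T r x : Set V) a ∧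
        3 * (k + 1) * a ≤ (k + 2) * (branch T r x).card
    · obtain ⟨x, a, ha, hc⟩ := hcut
      by_cases hx : x = r
      · subst hx
        rw [branch_root] at ha hc
        refine ⟨a, by simpa using ha, ?_⟩
        rw [card_univ, hn] at hc
        omega
      · obtain ⟨b, hb, hb'⟩ := ih (n - (branch T r x).card) (by have := hpos x; have := hle x; omega)
          _ (compl_branch_induce_isTree hT hx) (card_compl_branch.trans (by rw [hn]))
        refine ⟨a + b, Covers.of_branch ha hb, ?_⟩
        obtain ⟨d, hd⟩ := Nat.exists_eq_add_of_le (hle x)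
        rw [hd, Nat.add_sub_cancel_left] at hb'
        rw [hd]
        linarith [mul_add (3 * (k + 1)) a b, mul_add (k + 2) (branch T r x).card d]
    push Not at hcut
    have hthird : ∀ z, (branch T r z).card ≤ 3 * k →
        (k + 2) * (branch T r z).card < 3 * (k + 1) * (((branch T r z).card + 2) / 3) := by
      intro z hz
      exact hcut z _ ((covers_univ_third (branch T r z).card _
        (branch_induce_isTree hT) (by simp)).of_induce.mono (by omega) le_rfl le_rfl)
    -- the comparison of `⌈s / 3⌉` with `c * s`, by the residue of `s` modulo three
    have hs : ∀ z, (branch T r z).card ≤ 3 * k → (branch T r z).card % 3 ≠ 0 ∧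
        (k < (branch T r z).card → (branch T r z).card % 3 = 1) ∧
        (branch T r z).card ≤ 2 * k + 1 := by
      intro z hz
      have h := hthird z hz
      generalize (branch T r z).card = s at *
      have hs : s = 3 * (s / 3) + s % 3 := by omega
      generalize s / 3 = q at hs
      have h3 : s % 3 < 3 := Nat.mod_lt _ (by norm_num)
      generalize s % 3 = t at *
      interval_cases t
      · have : (s + 2) / 3 = q := by omega
        rw [this, hs] at h
        nlinarith
      · have : (s + 2) / 3 = q + 1 := by omega
        rw [this, hs] at h
        refine ⟨by norm_num, by norm_num, ?_⟩
        nlinarith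
      · have : (s + 2) / 3 = q + 1 := by omega
        rw [this, hs] at h
        have : s ≤ k := by nlinarith
        omega
    by_cases hn3 : n ≤ 3 * k
    · refine ⟨(n + 2) / 3, (covers_univ_third n T hT hn).mono (by omega) le_rfl le_rfl, ?_⟩
      have h1 : 3 * ((n + 2) / 3) ≤ n + 2 := by omega
      nlinarith
    obtain ⟨x, hx, hmin⟩ := exists_min_image
      (univ.filter fun z => 2 * k + 2 ≤ (branch T r z).card) (fun z => (branch T r z).card)
      ⟨r, by simp [branch_root, hn]; omega⟩
    obtain ⟨-, hx⟩ := mem_filter.1 hx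
    obtain ⟨m, hm, hm'⟩ := covers_branch hT hk (r := r) (x := x)
      (fun z _ hz => ⟨(hs z (by omega)).1, (hs z (by omega)).2.1⟩)
      (by by_contra h; have := (hs x (by omega)).2.2; omega)
      (fun y hy => by
        by_contra h
        have := hmin y (mem_filter.2 ⟨mem_univ _, by omega⟩)
        omega)
    exact absurd hm' (not_le.2 (hcut x m hm))

theorem mainTheorem1 {V : Type*} [Fintype V] (T : SimpleGraph V) (hT : T.IsTree)
    (k : ℕ) (hk : 3 ≤ k) (hrad : (k : ℕ∞) < T.radius) :
    (dominatingKBroadcastNumber T k : ℤ) ≤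
      ⌈(((k : ℚ) + 2) / ((k : ℚ) + 1)) * ((Fintype.card V : ℚ) / 3)⌉ := by
  obtain ⟨m, ⟨f, hf, hc, hd⟩, hm⟩ := exists_covers_univ hk (Fintype.card V) T hT rfl
  have hle : dominatingKBroadcastNumber T k ≤ m :=
    ((dominatingKBroadcastNumber_isLeast T k (by omega)).2
      ⟨f, ⟨hf, fun u => hd u trivial⟩, rfl⟩).trans hc
  refine le_trans (by exact_mod_cast hle : (dominatingKBroadcastNumber T k : ℤ) ≤ (m : ℤ)) ?_
  rw [Int.le_ceil_iff, div_mul_div_comm, lt_div_iff₀ (by positivity)]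
  have hm' : (3 * (k + 1) * m : ℚ) < (k + 2) * Fintype.card V + 3 * (k + 1) := by
    exact_mod_cast hm
  push_cast
  linarith
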